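/- Let $n\ge 1$ and let $1\le r_1<p_1\le q_1<\infty$, $1\le r_2<p_2<\infty$, $1<p\le q<s\le\infty$ satisfy $\frac1p=\frac1{p_1}+\frac1{p_2}$ and $\frac1q=\frac1{q_1}+\frac1{p_2}$. Put $\beta_1:=r_1\left(\frac1{p_1}-\frac1{q_1}\right)$, and let $q',s'$ be the conjugate exponents of $q,s$ (with $s'=1$ if $s=\infty$). For a cube $Q\subset\mathbb R^n$ with sides parallel to the axes, $0<r<\infty$ and a measurable $f\ge0$, let $\langle f\rangle_{r,Q}:=\left(\frac1{|Q|}\int_Q f^r\right)^{1/r}$. A weight is a measurable function that is positive almost everywhere. For weights $\lambda_1,\omega_2$ on $\mathbb R^n$ let $$[(\lambda_1,\omega_2)]_{A_{\vec q,\vec r}}:=\sup_Q\ \langle \lambda_1\omega_2\rangle_{\frac{sq}{s-q},Q}\ \langle\lambda_1^{-1}\rangle_{\frac{r_1q_1}{q_1-r_1},Q}\ \langle\omega_2^{-1}\rangle_{\frac{r_2p_2}{p_2-r_2},Q},\qquad \vec q=(q_1,p_2),\ \vec r=(r_1,r_2,s'),$$ the supremum being over all such cubes, where $\frac{sq}{s-q}$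 is read as $q$ if $s=\infty$; write $(\lambda_1,\omega_2)\in A_{\vec q,\vec r}$ if this is finite. For a cube $Q$ let $\mathcal D(Q)$ be the collection of cubes obtained from $Q$ by repeated subdivision into $2^n$ congruent (half-open) subcubes, $Q$ included. A dyadic lattice $\mathscr D$ is a collection of half-open cubes such that $\mathcal D(Q)\subset\mathscr D$ for every $Q\in\mathscr D$, any $Q',Q''\in\mathscr D$ both belong to $\mathcal D(Q)$ for some $Q\in\mathscr D$, and every compact subset of $\mathbb R^n$ is contained in some $Q\in\mathscr D$. For $\eta\in(0,1)$, a collection $\mathcal S$ of cubes is $\eta$-sparse if there are pairwise disjoint measurable sets $E_Q\subset Q$, $Q\in\mathcal S$, with $|E_Q|\ge\eta|Q|$. Assume that $(\lambda_1,\omega_2)\in A_{\vec q,\vec r}$ and let $\eta\in(0,1)$. Then there is a finite constant $C$, depending only on $n$, the exponents $r_1,r_2,p_1,p_2,q_1,s$, on $\eta$, and on an upper bound for $[(\lambda_1,\omega_2)]_{A_{\vec q,\vec r}}$, such that for every dyadic lattice $\mathscr D$, every $\eta$-sparse family $\mathcal S\subset\mathscr D$, and all $f_1\in L^{p_1}(\lambda_1^{p_1})$,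 $f_2\in L^{p_2}(\omega_2^{p_2})$, $g\in L^{q'}\big((\lambda_1\omega_2)^{-q'}\big)$, $$\sum_{Q\in\mathcal S}\langle|f_1|\rangle_{\frac{r_1}{1+\beta_1},Q}\,\langle|f_2|\rangle_{r_2,Q}\,\langle|g|\rangle_{s',Q}\,|Q|^{1+\frac{\beta_1}{r_1}}\le C\,\|f_1\lambda_1\|_{L^{p_1}}\,\|f_2\omega_2\|_{L^{p_2}}\,\|g(\lambda_1\omega_2)^{-1}\|_{L^{q'}} .$$ -/

import Mathlib

open MeasureTheory Set
open scoped ENNReal NNReal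

namespace SparseForm

/-- A cube in `ℝⁿ` with sides parallel to the axes, given by its lower corner and side length.
The space `ℝⁿ` is `Fin n → ℝ` with Lebesgue measure `volume`; no norm on `ℝⁿ` is ever used. -/
structure Cube (n : ℕ) where
  /-- the lower corner -/
  corner : Fin n → ℝ
  /-- the side length -/
  side : ℝ
  side_pos : 0 < side

/-- The half-open point set `∏ᵢ [cᵢ, cᵢ + ℓ)` of a cube. -/
def Cube.toSet {n : ℕ} (Q : Cube n) : Set (Fin n → ℝ) :=
  {x | ∀ i, Q.corner i ≤ x i ∧ x i < Q.corner i + Q.side}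

/-- `𝓓(Q)`: the cubes obtained from `Q` by repeated subdivision into `2ⁿ` congruent subcubes.
After `k` subdivisions these are the cubes of side `ℓ(Q) / 2ᵏ` on the grid of that mesh in `Q`. -/
def Cube.dyadicCubes {n : ℕ} (Q : Cube n) : Set (Cube n) :=
  {P | ∃ k : ℕ, P.side = Q.side / 2 ^ k ∧
    ∀ i, ∃ m : ℕ, m < 2 ^ k ∧ P.corner i = Q.corner i + m * (Q.side / 2 ^ k)}

/-- Dyadic lattices of cubes in `ℝⁿ`. -/
structure IsDyadicLattice {n : ℕ} (D : Set (Cube n)) : Prop where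
  dyadicCubes_subset : ∀ Q ∈ D, Q.dyadicCubes ⊆ D
  common_ancestor : ∀ P₁ ∈ D, ∀ P₂ ∈ D, ∃ Q ∈ D, P₁ ∈ Q.dyadicCubes ∧ P₂ ∈ Q.dyadicCubes
  compact_subset : ∀ K : Set (Fin n → ℝ), IsCompact K → ∃ Q ∈ D, K ⊆ Q.toSet

/-- `η`-sparse families of cubes. -/
def IsSparse {n : ℕ} (η : ℝ) (S : Set (Cube n)) : Prop :=
  ∃ E : Cube n → Set (Fin n → ℝ),
    (∀ Q ∈ S, MeasurableSet (E Q) ∧ E Q ⊆ Q.toSet ∧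
      ENNReal.ofReal η * volume Q.toSet ≤ volume (E Q)) ∧
    S.PairwiseDisjoint E

/-- The average `⟨f⟩_{r,Q} = (|Q|⁻¹ ∫_Q f ^ r) ^ (1/r)` of a nonnegative function, `0 < r < ∞`. -/
noncomputable def cubeAvg {n : ℕ} (r : ℝ) (f : (Fin n → ℝ) → ℝ≥0∞) (Q : Cube n) : ℝ≥0∞ :=
  ((volume Q.toSet)⁻¹ * ∫⁻ x in Q.toSet, f x ^ r) ^ (1 / r)

/-- A weight: a measurable function that is positive almost everywhere. -/
structure IsWeight {n : ℕ} (w : (Fin n → ℝ) → ℝ) : Prop where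
  aemeasurable : AEMeasurable w volume
  ae_pos : ∀ᵐ x ∂volume, 0 < w x

/-- The factor `⟨w⁻¹⟩_{rp/(p-r),Q}`, read as `ess sup_Q w⁻¹` when `p = r`. -/
noncomputable def dualFactor {n : ℕ} (r p : ℝ) (w : (Fin n → ℝ) → ℝ) (Q : Cube n) : ℝ≥0∞ :=
  if p = r then essSup (fun x => (ENNReal.ofReal (w x))⁻¹) (volume.restrict Q.toSet)
  else cubeAvg (r * p / (p - r)) (fun x => (ENNReal.ofReal (w x))⁻¹) Q

/-- The factor `⟨w⟩_{r'p/(r'-p),Q}` with `1/r + 1/r' = 1`, read as `⟨w⟩_{p,Q}` when `r = 1`. -/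
noncomputable def productFactor {n : ℕ} (r p : ℝ) (w : (Fin n → ℝ) → ℝ) (Q : Cube n) : ℝ≥0∞ :=
  if r = 1 then cubeAvg p (fun x => ENNReal.ofReal (w x)) Q
  else cubeAvg (r.conjExponent * p / (r.conjExponent - p)) (fun x => ENNReal.ofReal (w x)) Q

/-- The characteristic `[(w₁, w₂)]_{A_{(p₁,p₂),(r₁,r₂,r₃)}}`, where `1/p = 1/p₁ + 1/p₂`,
`1 ≤ rᵢ ≤ pᵢ < ∞` for `i = 1, 2`, and `p < r₃' ≤ ∞`. The pair of weights belongs to the class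
`A_{(p₁,p₂),(r₁,r₂,r₃)}` when it is finite. -/
noncomputable def weightConst {n : ℕ} (p₁ p₂ r₁ r₂ r₃ : ℝ) (w₁ w₂ : (Fin n → ℝ) → ℝ) : ℝ≥0∞ :=
  ⨆ Q : Cube n, productFactor r₃ (1 / p₁ + 1 / p₂)⁻¹ (fun x => w₁ x * w₂ x) Q *
    dualFactor r₁ p₁ w₁ Q * dualFactor r₂ p₂ w₂ Q

/-- The measure `w ^ a dx`, so that `L^p(w ^ a)` is `MemLp · p (weightMeasure w a)`. -/
noncomputable def weightMeasure {n : ℕ} (w : (Fin n → ℝ) → ℝ) (a : ℝ) : Measure (Fin n → ℝ) :=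
  volume.withDensity fun x => ENNReal.ofReal (w x ^ a)

/-- The fractional bilinear sparse form
`∑_{Q ∈ S} ⟨|f₁|⟩_{t₁,Q} ⟨|f₂|⟩_{t₂,Q} ⟨|g|⟩_{t₃,Q} |Q| ^ γ`. -/
noncomputable def sparseForm {n : ℕ} (S : Set (Cube n)) (t₁ t₂ t₃ γ : ℝ)
    (f₁ f₂ g : (Fin n → ℝ) → ℂ) : ℝ≥0∞ :=
  ∑' Q : S, cubeAvg t₁ (fun x => ‖f₁ x‖ₑ) Q * cubeAvg t₂ (fun x => ‖f₂ x‖ₑ) Q *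
    cubeAvg t₃ (fun x => ‖g x‖ₑ) Q * volume (Q : Cube n).toSet ^ γ

end SparseForm

namespace SparseForm

/-! ### Cubes -/

/-! The form is treated as a symmetric one in three functions, with weights `v = (λ₁, ω₂, (λ₁ω₂)⁻¹)`
of product one and norm exponents `P = (p₁, p₂, q')`. Let `t = (r₁/(1+β₁), r₂, s')` be the exponents
of the averages and `α i = 1/t i - 1/P i > 0`. For the densities `w i = v i ^ (-1/α i)` one has `∏ w
i ^ α i = 1`, and the characteristic is the supremum of `∏ (w i (Q)/|Q|) ^ α i`.

Each average is rewritten with respect to `w i dx`, which produces the factor `(w i (Q)/|Q|) ^ (1/t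
i)`. With `κ = (1/q₁, 1/p₂, 1/q')`, which sums to one, the exponent splits as `1/t = α + κ + (1/P -
κ)`. The `α` share is bounded by the characteristic. In the share `1/P - κ`, the extra power of
`|Q|` leaves `w i (Q) ^ (1/P - κ)`, which Hölder's inequality trades for a power of the norm
(`measure_rpow_mul_average_rpow_le`). In the `κ` share, `w i (Q)` is replaced by a multiple of `w i
(E_Q)` (`withDensity_rpow_le_of_subset`). Hölder's inequality for sums with exponents `κ` then
separates the three functions, and each sum is bounded by the dyadic maximal theorem in `L^(P/t)(w
i)` (`sum_average_rpow_mul_measure_le`), where `P/t > 1` and no doubling is needed. -/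

theorem Cube.toSet_eq_pi {n : ℕ} (Q : Cube n) :
    Q.toSet = univ.pi fun i => Ico (Q.corner i) (Q.corner i + Q.side) := by
  ext x
  simp [Cube.toSet]

theorem Cube.measurableSet_toSet {n : ℕ} (Q : Cube n) : MeasurableSet Q.toSet := by
  rw [Q.toSet_eq_pi]
  exact MeasurableSet.univ_pi fun i => measurableSet_Ico

theorem Cube.volume_toSet {n : ℕ} (Q : Cube n) :
    volume Q.toSet = ENNReal.ofReal Q.side ^ n := by
  rw [Q.toSet_eq_pi, Real.volume_pi_Ico]
  simp

theorem Cube.volume_ne_zero {n : ℕ} (Q : Cube n) : volume Q.toSet ≠ 0 := by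
  rw [Q.volume_toSet]
  exact pow_ne_zero _ (by simpa using Q.side_pos)

theorem Cube.volume_ne_top {n : ℕ} (Q : Cube n) : volume Q.toSet ≠ ∞ := by
  rw [Q.volume_toSet]
  exact ENNReal.pow_ne_top ENNReal.ofReal_ne_top

/-- Either the first cube is contained in the second, or they are disjoint, when both are obtained
from a common cube by subdivision and the first is not larger. -/
theorem Cube.subset_or_disjoint_of_subdivision {n : ℕ} (c : Fin n → ℝ) {L : ℝ} (hL : 0 < L)
    {P₁ P₂ : Cube n} {k d : ℕ} (hs₁ : P₁.side = L / 2 ^ k)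
    (hc₁ : ∀ i, ∃ m : ℕ, P₁.corner i = c i + m * (L / 2 ^ k))
    (hs₂ : P₂.side = L / 2 ^ (k + d))
    (hc₂ : ∀ i, ∃ m : ℕ, P₂.corner i = c i + m * (L / 2 ^ (k + d))) :
    P₂.toSet ⊆ P₁.toSet ∨ Disjoint P₁.toSet P₂.toSet := by
  choose m₁ hm₁ using hc₁
  choose m₂ hm₂ using hc₂
  set a := L / 2 ^ (k + d) with ha
  have ha0 : 0 < a := by positivity
  have hLa : L / 2 ^ k = 2 ^ d * a := by
    rw [ha, pow_add]; field_simp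
  rw [hLa] at hs₁ hm₁
  -- In units of the fine mesh `a`, the sides are `[m₁ 2^d, (m₁+1) 2^d)` and `[m₂, m₂+1)`. Since the
  -- endpoints are integers, failure of inclusion in one coordinate forces separation there.
  by_cases h : ∀ i, m₁ i * 2 ^ d ≤ m₂ i ∧ m₂ i + 1 ≤ (m₁ i + 1) * 2 ^ d
  · left
    intro x hx i
    have hxi := hx i
    rw [hm₂, hs₂] at hxi
    rw [hm₁, hs₁]
    have h1 : (m₁ i : ℝ) * 2 ^ d ≤ m₂ i := by exact_mod_cast (h i).1
    have h2 : (m₂ i : ℝ) + 1 ≤ (m₁ i + 1) * 2 ^ d := by exact_mod_cast (h i).2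
    have h3 := mul_le_mul_of_nonneg_right h1 ha0.le
    have h4 := mul_le_mul_of_nonneg_right h2 ha0.le
    constructor <;> nlinarith
  · right
    push Not at h
    obtain ⟨i, hi⟩ := h
    rw [Set.disjoint_left]
    intro x hx₁ hx₂
    have hx1 := hx₁ i
    have hx2 := hx₂ i
    rw [hm₂, hs₂] at hx2
    rw [hm₁, hs₁] at hx1
    rcases lt_or_ge (m₂ i) (m₁ i * 2 ^ d) with hlt | hge
    · have h1 : (m₂ i : ℝ) + 1 ≤ m₁ i * 2 ^ d := by exact_mod_cast hlt
      have h3 := mul_le_mul_of_nonneg_right h1 ha0.le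
      nlinarith
    · have h1 : ((m₁ i : ℝ) + 1) * 2 ^ d ≤ m₂ i := by
        exact_mod_cast Nat.lt_succ_iff.mp (hi hge)
      have h3 := mul_le_mul_of_nonneg_right h1 ha0.le
      nlinarith

theorem IsDyadicLattice.nested_or_disjoint {n : ℕ} {D : Set (Cube n)} (hD : IsDyadicLattice D)
    {P₁ P₂ : Cube n} (h₁ : P₁ ∈ D) (h₂ : P₂ ∈ D) :
    P₁.toSet ⊆ P₂.toSet ∨ P₂.toSet ⊆ P₁.toSet ∨ Disjoint P₁.toSet P₂.toSet := by
  obtain ⟨Q, -, ⟨k₁, hs₁, hc₁⟩, ⟨k₂, hs₂, hc₂⟩⟩ := hD.common_ancestor P₁ h₁ P₂ h₂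
  have hc₁' := fun i => (hc₁ i).imp fun m hm => hm.2
  have hc₂' := fun i => (hc₂ i).imp fun m hm => hm.2
  rcases le_total k₁ k₂ with h | h
  · obtain ⟨d, rfl⟩ := Nat.exists_eq_add_of_le h
    exact Or.inr (Cube.subset_or_disjoint_of_subdivision Q.corner Q.side_pos hs₁ hc₁' hs₂ hc₂')
  · obtain ⟨d, rfl⟩ := Nat.exists_eq_add_of_le h
    rcases Cube.subset_or_disjoint_of_subdivision Q.corner Q.side_pos hs₂ hc₂' hs₁ hc₁' with h | h
    · exact Or.inl h
    · exact Or.inr (Or.inr h.symm)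

/-! ### The maximal theorem for nested families -/

section Maximal

variable {X I : Type*} [MeasurableSpace X]

/-- Nestedness replaces a covering lemma: the union is the disjoint union of the maximal members, so
nothing is lost and the measures are arbitrary. The induction drops a set lying in another member; a
set lying in no other member absorbs all those it meets and is split off. -/
theorem measure_biUnion_le_of_nested {μ ν : Measure X} {B : I → Set X}
    (hB : ∀ i, MeasurableSet (B i)) (c : ℝ≥0∞) (T : Finset I)
    (hnest : ∀ i ∈ T, ∀ j ∈ T, B i ⊆ B j ∨ B j ⊆ B i ∨ Disjoint (B i) (B j))
    (hc : ∀ i ∈ T, c * μ (B i) ≤ ν (B i)) :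
    c * μ (⋃ i ∈ T, B i) ≤ ν (⋃ i ∈ T, B i) := by
  classical
  induction T using Finset.strongInduction with
  | H T ih =>
    rcases T.eq_empty_or_nonempty with rfl | ⟨i, hi⟩
    · simp
    by_cases hex : ∃ j ∈ T, j ≠ i ∧ B i ⊆ B j
    · obtain ⟨j, hj, hji, hij⟩ := hex
      have hU : (⋃ l ∈ T, B l) = ⋃ l ∈ T.erase i, B l := by
        apply Subset.antisymm
        · refine iUnion₂_subset fun l hl => ?_
          by_cases hli : l = i
          · subst hli
            exact hij.trans (subset_biUnion_of_mem (u := B)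
              (Finset.mem_coe.2 (Finset.mem_erase.2 ⟨hji, hj⟩)))
          · exact subset_biUnion_of_mem (u := B)
              (Finset.mem_coe.2 (Finset.mem_erase.2 ⟨hli, hl⟩))
        · exact biUnion_subset_biUnion_left fun l hl => Finset.mem_of_mem_erase hl
      rw [hU]
      exact ih _ (Finset.erase_ssubset hi)
        (fun a ha b hb => hnest a (Finset.mem_of_mem_erase ha) b (Finset.mem_of_mem_erase hb))
        (fun a ha => hc a (Finset.mem_of_mem_erase ha))
    · push Not at hex
      set T' := (T.erase i).filter fun j => Disjoint (B i) (B j) with hT'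
      have hsub : T' ⊆ T := (Finset.filter_subset _ _).trans (Finset.erase_subset _ _)
      have hU : (⋃ l ∈ T, B l) = B i ∪ ⋃ l ∈ T', B l := by
        apply Subset.antisymm
        · refine iUnion₂_subset fun l hl => ?_
          by_cases hli : l = i
          · subst hli
            exact subset_union_left
          · rcases hnest i hi l hl with h | h | h
            · exact absurd h (hex l hl hli)
            · exact h.trans subset_union_left
            · exact (subset_biUnion_of_mem (u := B) (Finset.mem_coe.2
                (Finset.mem_filter.2 ⟨Finset.mem_erase.2 ⟨hli, hl⟩, h⟩))).trans
                subset_union_right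
        · exact union_subset (subset_biUnion_of_mem (u := B) (Finset.mem_coe.2 hi))
            (biUnion_subset_biUnion_left hsub)
      have hd : Disjoint (B i) (⋃ l ∈ T', B l) := by
        simp only [disjoint_iUnion_right]
        exact fun l hl => (Finset.mem_filter.1 hl).2
      have hm : MeasurableSet (⋃ l ∈ T', B l) := T'.measurableSet_biUnion fun l _ => hB l
      rw [hU, measure_union hd hm, measure_union hd hm, mul_add]
      refine add_le_add (hc i hi) (ih T' ?_ (fun a ha b hb => hnest a (hsub ha) b (hsub hb))
        (fun a ha => hc a (hsub ha)))
      exact lt_of_le_of_lt (Finset.filter_subset _ _) (Finset.erase_ssubset hi)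

/-- The weak type estimate, localised to the large values of the function. -/
theorem measure_biUnion_lt_average_le {μ : Measure X} {B : I → Set X}
    (hB : ∀ i, MeasurableSet (B i)) {u : X → ℝ≥0∞} (hu : Measurable u) (T : Finset I)
    (hnest : ∀ i ∈ T, ∀ j ∈ T, B i ⊆ B j ∨ B j ⊆ B i ∨ Disjoint (B i) (B j))
    {t : ℝ≥0∞} (ht : t ≠ ∞) (hT : ∀ i ∈ T, t < (μ (B i))⁻¹ * ∫⁻ x in B i, u x ∂μ) :
    t / 2 * μ (⋃ i ∈ T, B i) ≤ ∫⁻ x, {x | t / 2 < u x}.indicator u x ∂μ := by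
  have hset : MeasurableSet {x | t / 2 < u x} := measurableSet_lt measurable_const hu
  -- The values of `u` not exceeding `t / 2` contribute at most half of `t * μ (B i)`, so the large
  -- values alone carry the other half on each `B i`.
  have key := measure_biUnion_le_of_nested (μ := μ)
    (ν := μ.withDensity ({x | t / 2 < u x}.indicator u)) hB (t / 2) T hnest ?_
  · refine key.trans ((measure_mono (subset_univ _)).trans ?_)
    rw [withDensity_apply _ MeasurableSet.univ, Measure.restrict_univ]
  · intro i hi
    have hti := hT i hi
    -- Infinite measure would give the average the value `∞⁻¹ * _ = 0`, which does not exceed `t`.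
    have hfin : μ (B i) ≠ ∞ := by
      intro h
      simp [h] at hti
    rw [withDensity_apply _ (hB i)]
    have h1 : t * μ (B i) ≤ ∫⁻ x in B i, u x ∂μ := by
      refine (mul_le_mul_left hti.le _).trans ?_
      rw [mul_comm, ← mul_assoc]
      exact (mul_le_mul_left (ENNReal.mul_inv_le_one _) _).trans (one_mul _).le
    have h2 : ∫⁻ x in B i, u x ∂μ ≤
        ∫⁻ x in B i, {x | t / 2 < u x}.indicator u x ∂μ + t / 2 * μ (B i) := by
      calc ∫⁻ x in B i, u x ∂μ
          ≤ ∫⁻ x in B i, ({x | t / 2 < u x}.indicator u x + t / 2) ∂μ := by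
            refine lintegral_mono fun x => ?_
            by_cases hx : t / 2 < u x
            · rw [indicator_of_mem (show x ∈ {x | t / 2 < u x} from hx)]
              exact le_self_add
            · exact (not_lt.1 hx).trans le_add_self
        _ = _ := by
            rw [lintegral_add_right _ measurable_const, setLIntegral_const]
    have h3 : t / 2 * μ (B i) + t / 2 * μ (B i) = t * μ (B i) := by
      rw [← add_mul, ENNReal.add_halves]
    have hne : t / 2 * μ (B i) ≠ ∞ :=
      ENNReal.mul_ne_top (ENNReal.div_ne_top ht (by simp)) hfin
    rw [← ENNReal.add_le_add_iff_right hne, h3]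
    exact h1.trans h2

/-- The layer cake formula for a single value. -/
theorem lintegral_rpow_sub_one_indicator (A : ℝ≥0∞) {b : ℝ} (hb : 0 < b) :
    ENNReal.ofReal b * ∫⁻ t in Ioi (0 : ℝ),
      (if ENNReal.ofReal t < A then 1 else 0) * ENNReal.ofReal (t ^ (b - 1)) = A ^ b := by
  have key : ∀ A : ℝ≥0∞, A ≠ ∞ → ENNReal.ofReal b * ∫⁻ t in Ioi (0 : ℝ),
      (if ENNReal.ofReal t < A then 1 else 0) * ENNReal.ofReal (t ^ (b - 1)) = A ^ b := by
    intro A hA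
    -- Layer cake for a constant function on a one-point probability space.
    have h := lintegral_rpow_eq_lintegral_meas_lt_mul (Measure.dirac ()) (f := fun _ => A.toReal)
      (Filter.Eventually.of_forall fun _ => ENNReal.toReal_nonneg) aemeasurable_const hb
    rw [lintegral_const, measure_univ, mul_one,
      ← ENNReal.ofReal_rpow_of_nonneg ENNReal.toReal_nonneg hb.le, ENNReal.ofReal_toReal hA] at h
    rw [h]
    congr 1
    refine setLIntegral_congr_fun measurableSet_Ioi fun t ht => ?_
    by_cases htA : ENNReal.ofReal t < A
    · have : t < A.toReal := by
        rwa [ENNReal.ofReal_lt_iff_lt_toReal (le_of_lt ht) hA] at htA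
      simp [htA, this]
    · have : ¬ t < A.toReal := by
        rwa [ENNReal.ofReal_lt_iff_lt_toReal (le_of_lt ht) hA] at htA
      simp [htA, this]
  by_cases hA : A = ∞
  · subst hA
    rw [ENNReal.top_rpow_of_pos hb]
    refine ENNReal.eq_top_of_forall_nnreal_le fun N => ?_
    have hN := key ((N : ℝ≥0∞) ^ (1 / b)) (by simp [hb.le])
    rw [← ENNReal.rpow_mul, one_div, inv_mul_cancel₀ hb.ne', ENNReal.rpow_one] at hN
    rw [← hN]
    gcongr with t
    split_ifs <;> simp_all
  · exact key A hA

/-- The constant in the maximal theorem below. -/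
noncomputable def maximalConst (a : ℝ) : ℝ≥0∞ :=
  ENNReal.ofReal a * 2 * ((ENNReal.ofReal (a - 1))⁻¹ * 2 ^ (a - 1))

theorem maximalConst_ne_top {a : ℝ} (ha : 1 < a) : maximalConst a ≠ ∞ := by
  have h1 : (ENNReal.ofReal (a - 1))⁻¹ ≠ ∞ := by simpa using ha
  have h2 : (2 : ℝ≥0∞) ^ (a - 1) ≠ ∞ := ENNReal.rpow_ne_top_of_nonneg (by linarith) (by simp)
  unfold maximalConst
  finiteness

/-- The maximal theorem, linearised over disjoint parts of a finite nested family. -/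
theorem sum_average_rpow_mul_measure_le {μ : Measure X} [SFinite μ] {B E : I → Set X}
    (hB : ∀ i, MeasurableSet (B i)) {u : X → ℝ≥0∞} (hu : Measurable u) (T : Finset I)
    (hnest : ∀ i ∈ T, ∀ j ∈ T, B i ⊆ B j ∨ B j ⊆ B i ∨ Disjoint (B i) (B j))
    (hE : ∀ i ∈ T, MeasurableSet (E i)) (hEB : ∀ i ∈ T, E i ⊆ B i)
    (hdisj : (T : Set I).PairwiseDisjoint E) {a : ℝ} (ha : 1 < a) :
    ∑ i ∈ T, ((μ (B i))⁻¹ * ∫⁻ x in B i, u x ∂μ) ^ a * μ (E i) ≤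
      maximalConst a * ∫⁻ x, u x ^ a ∂μ := by
  classical
  set A : I → ℝ≥0∞ := fun i => (μ (B i))⁻¹ * ∫⁻ x in B i, u x ∂μ with hA
  have ha0 : 0 < a := by linarith
  have hmeas : ∀ c : ℝ≥0∞, Measurable fun t : ℝ => if ENNReal.ofReal t < c then (1 : ℝ≥0∞) else 0 :=
    fun c => Measurable.ite (measurableSet_lt ENNReal.measurable_ofReal measurable_const)
      measurable_const measurable_const
  have hpow : ∀ b : ℝ, Measurable fun t : ℝ => ENNReal.ofReal (t ^ b) := fun b => by fun_prop
  -- The weak type bound at height `t`, times `t ^ (a - 1)`. The factor `t / 2` in that bound uses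
  -- up one power of `t`; the remaining `t ^ (a - 2)` integrates over `(0, 2u)` to `(2u) ^ (a - 1) /
  -- (a - 1)`, which is where `1 < a` enters.
  have level : ∀ t ∈ Ioi (0 : ℝ),
      ∑ i ∈ T, (if ENNReal.ofReal t < A i then 1 else 0) * ENNReal.ofReal (t ^ (a - 1)) * μ (E i) ≤
      ∫⁻ x, 2 * (u x * ((if ENNReal.ofReal t < 2 * u x then 1 else 0) *
        ENNReal.ofReal (t ^ (a - 1 - 1)))) ∂μ := by
    intro t ht
    have ht' : (0 : ℝ) < t := ht
    set S := T.filter fun i => ENNReal.ofReal t < A i with hS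
    have hST : S ⊆ T := Finset.filter_subset _ _
    have hweak := measure_biUnion_lt_average_le (μ := μ) hB hu S
      (fun i hi j hj => hnest i (hST hi) j (hST hj)) (ENNReal.ofReal_ne_top (r := t))
      (fun i hi => (Finset.mem_filter.1 hi).2)
    have hEU : ∑ i ∈ S, μ (E i) ≤ μ (⋃ i ∈ S, B i) := by
      rw [← measure_biUnion_finset (hdisj.subset (by exact_mod_cast hST)) fun i hi => hE i (hST hi)]
      exact measure_mono (biUnion_mono subset_rfl fun i hi => hEB i (hST hi))
    have hsplit : ENNReal.ofReal (t ^ (a - 1)) =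
        ENNReal.ofReal (t ^ (a - 1 - 1)) * 2 * (ENNReal.ofReal t / 2) := by
      rw [mul_assoc, ENNReal.mul_div_cancel (by simp) (by simp),
        ← ENNReal.ofReal_mul (by positivity), ← Real.rpow_add_one ht'.ne']
      ring_nf
    calc ∑ i ∈ T, (if ENNReal.ofReal t < A i then 1 else 0) * ENNReal.ofReal (t ^ (a - 1)) * μ (E i)
        = ENNReal.ofReal (t ^ (a - 1)) * ∑ i ∈ S, μ (E i) := by
          rw [hS, Finset.sum_filter, Finset.mul_sum]
          refine Finset.sum_congr rfl fun i _ => ?_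
          split_ifs <;> simp
      _ ≤ ENNReal.ofReal (t ^ (a - 1 - 1)) * 2 * (ENNReal.ofReal t / 2 * μ (⋃ i ∈ S, B i)) := by
          rw [hsplit, mul_assoc _ (ENNReal.ofReal t / 2)]
          gcongr
      _ ≤ ENNReal.ofReal (t ^ (a - 1 - 1)) * 2 *
            ∫⁻ x, {x | ENNReal.ofReal t / 2 < u x}.indicator u x ∂μ := by gcongr
      _ = _ := by
          rw [← lintegral_const_mul _
            (hu.indicator (measurableSet_lt measurable_const hu))]
          refine lintegral_congr fun x => ?_
          have hiff : ENNReal.ofReal t / 2 < u x ↔ ENNReal.ofReal t < 2 * u x := by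
            rw [ENNReal.div_lt_iff (by simp) (by simp), mul_comm]
          by_cases hx : ENNReal.ofReal t < 2 * u x
          · rw [indicator_of_mem (show x ∈ {x | _ < u x} from hiff.2 hx), if_pos hx]
            ring
          · rw [indicator_of_notMem (show x ∉ {x | _ < u x} from fun h => hx (hiff.1 h)),
              if_neg hx]
            simp
  have hjoint : Measurable fun z : ℝ × X => 2 * (u z.2 *
      ((if ENNReal.ofReal z.1 < 2 * u z.2 then (1 : ℝ≥0∞) else 0) *
        ENNReal.ofReal (z.1 ^ (a - 1 - 1)))) := by
    refine (Measurable.mul (hu.comp measurable_snd) (Measurable.mul ?_ ?_)).const_mul 2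
    · exact Measurable.ite (measurableSet_lt (by fun_prop) (by fun_prop))
        measurable_const measurable_const
    · exact (hpow _).comp measurable_fst
  calc ∑ i ∈ T, A i ^ a * μ (E i)
      = ENNReal.ofReal a * ∫⁻ t in Ioi (0 : ℝ), ∑ i ∈ T,
          (if ENNReal.ofReal t < A i then 1 else 0) * ENNReal.ofReal (t ^ (a - 1)) * μ (E i) := by
        have hm : ∀ i, Measurable fun t : ℝ => (if ENNReal.ofReal t < A i then (1 : ℝ≥0∞) else 0) *
            ENNReal.ofReal (t ^ (a - 1)) := fun i => (hmeas _).mul (hpow _)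
        rw [lintegral_finsetSum _ fun i _ => (hm i).mul_const _, Finset.mul_sum]
        refine Finset.sum_congr rfl fun i _ => ?_
        rw [lintegral_mul_const _ (hm i), ← mul_assoc, lintegral_rpow_sub_one_indicator _ ha0]
    _ ≤ ENNReal.ofReal a * ∫⁻ t in Ioi (0 : ℝ), ∫⁻ x, 2 * (u x *
          ((if ENNReal.ofReal t < 2 * u x then 1 else 0) *
            ENNReal.ofReal (t ^ (a - 1 - 1)))) ∂μ := by
        gcongr ENNReal.ofReal a * ?_
        exact setLIntegral_mono' measurableSet_Ioi level
    _ = ENNReal.ofReal a * ∫⁻ x, (∫⁻ t in Ioi (0 : ℝ), 2 * (u x *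
          ((if ENNReal.ofReal t < 2 * u x then 1 else 0) *
            ENNReal.ofReal (t ^ (a - 1 - 1))))) ∂μ := by
        rw [lintegral_lintegral_swap hjoint.aemeasurable]
    _ = ENNReal.ofReal a * ∫⁻ x, 2 * ((ENNReal.ofReal (a - 1))⁻¹ * 2 ^ (a - 1)) * u x ^ a ∂μ := by
        congr 1
        refine lintegral_congr fun x => ?_
        have hm : Measurable fun t : ℝ => (if ENNReal.ofReal t < 2 * u x then (1 : ℝ≥0∞) else 0) *
            ENNReal.ofReal (t ^ (a - 1 - 1)) := (hmeas _).mul (hpow _)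
        rw [lintegral_const_mul _ (hm.const_mul _), lintegral_const_mul _ hm]
        have h := lintegral_rpow_sub_one_indicator (2 * u x) (b := a - 1) (by linarith)
        have hb0 : ENNReal.ofReal (a - 1) ≠ 0 := by simpa using ha
        rw [← ENNReal.eq_div_iff hb0 ENNReal.ofReal_ne_top] at h
        have hua : u x ^ a = u x * u x ^ (a - 1) := by
          conv_lhs => rw [show a = 1 + (a - 1) by ring]
          rw [ENNReal.rpow_add_of_nonneg _ _ zero_le_one (by linarith), ENNReal.rpow_one]
        rw [h, hua, ENNReal.mul_rpow_of_nonneg _ _ (by linarith : 0 ≤ a - 1), ENNReal.div_eq_inv_mul]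
        ring
    _ = maximalConst a * ∫⁻ x, u x ^ a ∂μ := by
        rw [lintegral_const_mul _ (hu.pow_const a), maximalConst]
        ring

end Maximal

end SparseForm

namespace SparseForm

/-! ### The multilinear sparse bound for dual weights -/

theorem rpow_finsetSum_of_nonneg {ι : Type*} {s : Finset ι} (x : ℝ≥0∞) {α : ι → ℝ}
    (hα : ∀ i ∈ s, 0 ≤ α i) : x ^ (∑ i ∈ s, α i) = ∏ i ∈ s, x ^ α i := by
  classical
  induction s using Finset.induction with
  | empty => simp
  | insert i s hi ih =>
    have hs : ∀ j ∈ s, 0 ≤ α j := fun j hj => hα j (Finset.mem_insert_of_mem hj)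
    rw [Finset.sum_insert hi, Finset.prod_insert hi, ENNReal.rpow_add_of_nonneg _ _
      (hα i (Finset.mem_insert_self _ _)) (Finset.sum_nonneg hs), ih hs]

section Multilinear

variable {ι : Type*} [Fintype ι]

/-- Hölder's inequality for finite sums and finitely many factors. -/
theorem sum_prod_rpow_le {I : Type*} (T : Finset I) (f : ι → I → ℝ≥0∞) {κ : ι → ℝ}
    (hκ : ∀ i, 0 ≤ κ i) (hκ1 : ∑ i, κ i = 1) :
    ∑ q ∈ T, ∏ i, f i q ^ κ i ≤ ∏ i, (∑ q ∈ T, f i q) ^ κ i := by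
  let _ : MeasurableSpace T := ⊤
  have h := ENNReal.lintegral_prod_norm_pow_le (μ := Measure.count) (α := T) Finset.univ
    (f := fun i q => f i q) (fun i _ => (measurable_from_top).aemeasurable) hκ1 fun i _ => hκ i
  simp only [lintegral_count, tsum_fintype] at h
  rw [Finset.sum_coe_sort T fun q => ∏ i, f i q ^ κ i] at h
  refine h.trans (le_of_eq (Finset.prod_congr rfl fun i _ => ?_))
  rw [Finset.sum_coe_sort T fun q => f i q]

variable {X : Type*} [MeasurableSpace X]

/-- The measure of a set is controlled by the measures with densities `w i` when the weighted
geometric mean of the densities is `1`. -/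
theorem measure_rpow_sum_le_prod {μ : Measure X} {w : ι → X → ℝ≥0∞} (hw : ∀ i, Measurable (w i))
    {α : ι → ℝ} (hα : ∀ i, 0 ≤ α i) (hα0 : 0 < ∑ i, α i) (hprod : ∀ x, ∏ i, w i x ^ α i = 1)
    {E : Set X} (hE : MeasurableSet E) :
    μ E ^ (∑ i, α i) ≤ ∏ i, μ.withDensity (w i) E ^ α i := by
  set τ := ∑ i, α i with hτ
  have h := ENNReal.lintegral_prod_norm_pow_le (μ := μ.restrict E) Finset.univ
    (f := w) (p := fun i => α i / τ) (fun i _ => (hw i).aemeasurable)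
    (by rw [← Finset.sum_div, ← hτ, div_self hα0.ne']) fun i _ => div_nonneg (hα i) hα0.le
  have h1 : ∀ x, ∏ i, w i x ^ (α i / τ) = 1 := fun x => by
    simp only [div_eq_mul_inv, ENNReal.rpow_mul]
    rw [ENNReal.prod_rpow_of_nonneg (inv_nonneg.2 hα0.le), hprod, ENNReal.one_rpow]
  simp only [h1, setLIntegral_one] at h
  calc μ E ^ τ ≤ (∏ i, (∫⁻ a in E, w i a ∂μ) ^ (α i / τ)) ^ τ := by gcongr
    _ = _ := by
        rw [← ENNReal.prod_rpow_of_nonneg hα0.le]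
        refine Finset.prod_congr rfl fun i _ => ?_
        rw [← ENNReal.rpow_mul, div_mul_cancel₀ _ hα0.ne', withDensity_apply _ hE]

/-- The densities of a family with bounded characteristic on `B` charge large subsets of `B`. -/
theorem withDensity_rpow_le_of_subset {μ : Measure X} {w : ι → X → ℝ≥0∞}
    (hw : ∀ i, Measurable (w i)) {α : ι → ℝ} (hα : ∀ i, 0 < α i)
    (hprod : ∀ x, ∏ i, w i x ^ α i = 1) {B E : Set X} (hE : MeasurableSet E) (hEB : E ⊆ B)
    (hB0 : μ B ≠ 0) (hBt : μ B ≠ ∞) {c K : ℝ≥0∞} (hc : c * μ B ≤ μ E)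
    (hK : ∏ i, ((μ B)⁻¹ * μ.withDensity (w i) B) ^ α i ≤ K) (i : ι) :
    c ^ (∑ j, α j) * μ.withDensity (w i) B ^ α i ≤ K * μ.withDensity (w i) E ^ α i := by
  classical
  have hα0 : 0 < ∑ j, α j := Finset.sum_pos (fun j _ => hα j) ⟨i, Finset.mem_univ i⟩
  set τ := ∑ j, α j with hτ
  have hE' := measure_rpow_sum_le_prod (μ := μ) hw (fun j => (hα j).le) hα0 hprod hE
  have hB0' : μ B ^ τ ≠ 0 := (ENNReal.rpow_pos (pos_iff_ne_zero.2 hB0) hBt).ne'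
  have hBt' : μ B ^ τ ≠ ∞ := ENNReal.rpow_ne_top_of_nonneg hα0.le hBt
  have hKB : ∏ j, μ.withDensity (w j) B ^ α j ≤ K * μ B ^ τ := by
    calc ∏ j, μ.withDensity (w j) B ^ α j
        = ∏ j, ((μ B)⁻¹ * μ.withDensity (w j) B) ^ α j * μ B ^ α j := by
          refine Finset.prod_congr rfl fun j _ => ?_
          rw [← ENNReal.mul_rpow_of_nonneg _ _ (hα j).le, mul_right_comm,
            ENNReal.inv_mul_cancel hB0 hBt, one_mul]
      _ = (∏ j, ((μ B)⁻¹ * μ.withDensity (w j) B) ^ α j) * μ B ^ τ := by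
          rw [Finset.prod_mul_distrib, hτ, rpow_finsetSum_of_nonneg _ fun j _ => (hα j).le]
      _ ≤ _ := by gcongr
  rw [← ENNReal.mul_le_mul_iff_right hB0' hBt']
  calc μ B ^ τ * (c ^ τ * μ.withDensity (w i) B ^ α i)
      = (c * μ B) ^ τ * μ.withDensity (w i) B ^ α i := by
        rw [ENNReal.mul_rpow_of_nonneg _ _ hα0.le]; ring
    _ ≤ (∏ j, μ.withDensity (w j) E ^ α j) * μ.withDensity (w i) B ^ α i := by
        gcongr
        exact (ENNReal.rpow_le_rpow hc hα0.le).trans hE'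
    -- Only the factor at `i` stays on `E`; the others are enlarged to `B`, and the spare `i`-th
    -- factor on `B` completes the product controlled by `K`.
    _ ≤ μ.withDensity (w i) E ^ α i * ∏ j, μ.withDensity (w j) B ^ α j := by
        rw [← Finset.mul_prod_erase _ _ (Finset.mem_univ i),
          ← Finset.mul_prod_erase Finset.univ (fun j => μ.withDensity (w j) B ^ α j)
            (Finset.mem_univ i), mul_assoc, mul_comm (μ.withDensity (w i) B ^ α i)]
        gcongr with j hj
        exact (hα j).le
    _ ≤ μ.withDensity (w i) E ^ α i * (K * μ B ^ τ) := by gcongr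
    _ = _ := by ring

/-- The constant in the multilinear sparse bound. -/
noncomputable def multilinearConst (α κ ρ : ι → ℝ) (c K : ℝ≥0∞) : ℝ≥0∞ :=
  K * (∏ i, (K / c ^ (∑ j, α j)) ^ (κ i / α i)) * ∏ i, maximalConst (ρ i / κ i) ^ κ i

theorem multilinearConst_ne_top {α κ ρ : ι → ℝ} (hα : ∀ i, 0 < α i) (hκ : ∀ i, 0 < κ i)
    (hρ : ∀ i, κ i < ρ i) {c K : ℝ≥0∞} (hc0 : c ≠ 0) (hct : c ≠ ∞) (hK : K ≠ ∞) :
    multilinearConst α κ ρ c K ≠ ∞ := by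
  refine ENNReal.mul_ne_top (ENNReal.mul_ne_top hK ?_) ?_
  · refine ENNReal.prod_ne_top fun i _ => ENNReal.rpow_ne_top_of_nonneg
      (div_pos (hκ i) (hα i)).le (ENNReal.div_ne_top hK ?_)
    exact (ENNReal.rpow_pos (pos_iff_ne_zero.2 hc0) hct).ne'
  · exact ENNReal.prod_ne_top fun i _ => ENNReal.rpow_ne_top_of_nonneg (hκ i).le
      (maximalConst_ne_top ((one_lt_div (hκ i)).2 (hρ i)))

/-- This is the non-fractional core. The powers `α i` are spent on `K`, the powers `κ i` turn each
cube into its disjoint part `E Q`, and the maximal theorem is applied with exponent `ρ i / κ i > 1`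
after Hölder's inequality for the sum. -/
theorem tsum_prod_average_le {n : ℕ} {D S : Set (Cube n)} (hD : IsDyadicLattice D) (hSD : S ⊆ D)
    {η : ℝ} (hη : 0 < η) (hS : IsSparse η S)
    {α κ ρ : ι → ℝ} (hα : ∀ i, 0 < α i) (hκ : ∀ i, 0 < κ i) (hκ1 : ∑ i, κ i = 1)
    (hρ : ∀ i, κ i < ρ i) {w u : ι → (Fin n → ℝ) → ℝ≥0∞} (hw : ∀ i, Measurable (w i))
    (hu : ∀ i, Measurable (u i)) (hprod : ∀ x, ∏ i, w i x ^ α i = 1) {K : ℝ≥0∞}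
    (hK : ∀ Q : Cube n,
      ∏ i, ((volume Q.toSet)⁻¹ * volume.withDensity (w i) Q.toSet) ^ α i ≤ K) :
    ∑' Q : S, volume (Q : Cube n).toSet * ∏ i,
      (((volume (Q : Cube n).toSet)⁻¹ * volume.withDensity (w i) (Q : Cube n).toSet) ^ (α i + κ i) *
      ((volume.withDensity (w i) (Q : Cube n).toSet)⁻¹ *
        ∫⁻ x in (Q : Cube n).toSet, u i x ∂volume.withDensity (w i)) ^ ρ i) ≤
    multilinearConst α κ ρ (ENNReal.ofReal η) K *
      ∏ i, (∫⁻ x, u i x ^ (ρ i / κ i) ∂volume.withDensity (w i)) ^ κ i := by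
  obtain ⟨E, hE, hdisj⟩ := hS
  set c := ENNReal.ofReal η with hc
  set τ := ∑ j, α j with hτ
  have hc0 : c ≠ 0 := by simpa [hc] using hη
  have hcτ0 : c ^ τ ≠ 0 := (ENNReal.rpow_pos (pos_iff_ne_zero.2 hc0) ENNReal.ofReal_ne_top).ne'
  have hcτt : c ^ τ ≠ ∞ :=
    ENNReal.rpow_ne_top_of_nonneg (Finset.sum_nonneg fun j _ => (hα j).le) ENNReal.ofReal_ne_top
  set A : ι → Cube n → ℝ≥0∞ := fun i Q => (volume.withDensity (w i) Q.toSet)⁻¹ *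
        ∫⁻ x in Q.toSet, u i x ∂volume.withDensity (w i) with hA
  have term : ∀ Q : S, volume (Q : Cube n).toSet * ∏ i,
      (((volume (Q : Cube n).toSet)⁻¹ * volume.withDensity (w i) (Q : Cube n).toSet) ^ (α i + κ i) *
      A i Q ^ ρ i) ≤ K * (∏ i, (K / c ^ τ) ^ (κ i / α i)) *
        ∏ i, (A i Q ^ (ρ i / κ i) * volume.withDensity (w i) (E Q)) ^ κ i := by
    rintro ⟨Q, hQ⟩
    obtain ⟨hEm, hEQ, hEv⟩ := hE Q hQ
    simp only
    have hQ0 := Q.volume_ne_zero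
    have hQt := Q.volume_ne_top
    -- Since the `κ i` sum to one, Lebesgue measure cancels and only the weighted measures remain.
    have h1 : volume Q.toSet * ∏ i, ((volume Q.toSet)⁻¹) ^ κ i = 1 := by
      rw [← rpow_finsetSum_of_nonneg _ fun i _ => (hκ i).le, hκ1, ENNReal.rpow_one,
        ENNReal.mul_inv_cancel hQ0 hQt]
    have h2 : ∀ i, volume.withDensity (w i) Q.toSet ^ κ i ≤
        (K / c ^ τ) ^ (κ i / α i) * volume.withDensity (w i) (E Q) ^ κ i := fun i => by
      have h := withDensity_rpow_le_of_subset hw hα hprod hEm hEQ hQ0 hQt hEv (hK Q) i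
      have h' : volume.withDensity (w i) Q.toSet ^ α i ≤
          K / c ^ τ * volume.withDensity (w i) (E Q) ^ α i := by
        rw [← ENNReal.mul_div_right_comm, ENNReal.le_div_iff_mul_le (Or.inl hcτ0) (Or.inl hcτt),
          mul_comm]
        exact h
      have hpos : 0 ≤ κ i / α i := (div_pos (hκ i) (hα i)).le
      have h3 := ENNReal.rpow_le_rpow h' hpos
      rwa [ENNReal.mul_rpow_of_nonneg _ _ hpos, ← ENNReal.rpow_mul, ← ENNReal.rpow_mul,
        mul_div_cancel₀ _ (hα i).ne'] at h3
    calc volume Q.toSet * ∏ i,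
          (((volume Q.toSet)⁻¹ * volume.withDensity (w i) Q.toSet) ^ (α i + κ i) * A i Q ^ ρ i)
        = (volume Q.toSet * ∏ i, ((volume Q.toSet)⁻¹) ^ κ i) *
          (∏ i, ((volume Q.toSet)⁻¹ * volume.withDensity (w i) Q.toSet) ^ α i) *
          ∏ i, (volume.withDensity (w i) Q.toSet ^ κ i * A i Q ^ ρ i) := by
          rw [mul_assoc, mul_assoc, ← Finset.prod_mul_distrib, ← Finset.prod_mul_distrib]
          congr 1
          refine Finset.prod_congr rfl fun i _ => ?_
          rw [ENNReal.rpow_add_of_nonneg _ _ (hα i).le (hκ i).le,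
            ENNReal.mul_rpow_of_nonneg _ _ (hκ i).le]
          ring
      _ ≤ 1 * K * ∏ i, ((K / c ^ τ) ^ (κ i / α i) * volume.withDensity (w i) (E Q) ^ κ i *
            A i Q ^ ρ i) := by
          rw [h1]
          gcongr with i _
          · exact hK Q
          · exact h2 i
      _ = _ := by
          rw [one_mul, mul_assoc, ← Finset.prod_mul_distrib]
          congr 1
          refine Finset.prod_congr rfl fun i _ => ?_
          rw [ENNReal.mul_rpow_of_nonneg _ _ (hκ i).le, ← ENNReal.rpow_mul,
            div_mul_cancel₀ _ (hκ i).ne']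
          ring
  refine (ENNReal.tsum_le_tsum term).trans ?_
  rw [ENNReal.tsum_mul_left, multilinearConst, mul_assoc (K * _)]
  refine mul_le_mul' le_rfl ?_
  rw [← Finset.prod_mul_distrib, ENNReal.tsum_eq_iSup_sum]
  refine iSup_le fun T => (sum_prod_rpow_le T _ (fun i => (hκ i).le) hκ1).trans ?_
  gcongr with i _
  rw [← ENNReal.mul_rpow_of_nonneg _ _ (hκ i).le]
  refine ENNReal.rpow_le_rpow ?_ (hκ i).le
  exact sum_average_rpow_mul_measure_le (μ := volume.withDensity (w i))
    (B := fun Q : S => (Q : Cube n).toSet) (E := fun Q : S => E Q)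
    (fun Q => (Q : Cube n).measurableSet_toSet) (hu i) T
    (fun P _ Q _ => hD.nested_or_disjoint (hSD P.2) (hSD Q.2))
    (fun Q _ => (hE Q Q.2).1) (fun Q _ => (hE Q Q.2).2.1)
    (fun P _ Q _ hPQ => hdisj P.2 Q.2 fun h => hPQ (Subtype.ext h))
    ((one_lt_div (hκ i)).2 (hρ i))

end Multilinear

end SparseForm

namespace SparseForm

/-! ### The multilinear sparse bound for weights -/

/-- The average of `F` in terms of the average of `F ^ t / w` with respect to `w dx`. -/
theorem cubeAvg_eq_mul_average {n : ℕ} {w F : (Fin n → ℝ) → ℝ≥0∞} (hw : Measurable w)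
    (hF : Measurable F) (hw0 : ∀ x, w x ≠ 0) (hwt : ∀ x, w x ≠ ∞) {t : ℝ} (ht : 0 < t) (Q : Cube n)
    (h0 : volume.withDensity w Q.toSet ≠ 0) (hfin : volume.withDensity w Q.toSet ≠ ∞) :
    cubeAvg t F Q = ((volume Q.toSet)⁻¹ * volume.withDensity w Q.toSet) ^ (1 / t) *
      ((volume.withDensity w Q.toSet)⁻¹ *
        ∫⁻ x in Q.toSet, F x ^ t * (w x)⁻¹ ∂volume.withDensity w) ^ (1 / t) := by
  have h : ∫⁻ x in Q.toSet, F x ^ t * (w x)⁻¹ ∂volume.withDensity w = ∫⁻ x in Q.toSet, F x ^ t := by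
    have hu : Measurable fun x => F x ^ t * (w x)⁻¹ := (hF.pow_const t).mul hw.inv
    rw [restrict_withDensity Q.measurableSet_toSet, lintegral_withDensity_eq_lintegral_mul _ hw hu]
    refine lintegral_congr fun x => ?_
    rw [Pi.mul_apply, mul_comm, mul_assoc, ENNReal.inv_mul_cancel (hw0 x) (hwt x), mul_one]
  rw [h, ← ENNReal.mul_rpow_of_nonneg _ _ (by positivity), cubeAvg, mul_assoc,
    ← mul_assoc (volume.withDensity w Q.toSet), ENNReal.mul_inv_cancel h0 hfin, one_mul]

/-- Fractional averages are controlled by a power of the average and a power of the norm. -/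
theorem measure_rpow_mul_average_rpow_le {X : Type*} [MeasurableSpace X] {μ : Measure X}
    {B : Set X} {u : X → ℝ≥0∞} (hu : Measurable u) {P t κ : ℝ} (ht : 0 < t) (htP : t < P)
    (hκ : 0 < κ) (hκP : κ ≤ 1 / P) (h0 : μ B ≠ 0) (hfin : μ B ≠ ∞) :
    μ B ^ (1 / P - κ) * ((μ B)⁻¹ * ∫⁻ x in B, u x ∂μ) ^ (1 / t) ≤
      ((∫⁻ x, u x ^ (P / t) ∂μ) ^ (1 / P)) ^ (1 - P * κ) *
        ((μ B)⁻¹ * ∫⁻ x in B, u x ∂μ) ^ (P * κ / t) := by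
  have hP : 0 < P := ht.trans htP
  have hPκ : P * κ ≤ 1 := by rwa [le_div_iff₀ hP, mul_comm] at hκP
  set N := ∫⁻ x, u x ^ (P / t) ∂μ with hN
  set Y := (μ B)⁻¹ * ∫⁻ x in B, u x ∂μ with hY
  have hpq : (P / t).HolderConjugate (P / t).conjExponent :=
    Real.HolderConjugate.conjExponent ((one_lt_div ht).2 htP)
  have hJ : μ B ^ (1 / P) * Y ^ (1 / t) ≤ N ^ (1 / P) := by
    have h1 : ∫⁻ x in B, u x ∂μ ≤ N ^ (t / P) * μ B ^ (1 - t / P) := by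
      have h := ENNReal.lintegral_mul_le_Lp_mul_Lq (μ.restrict B) hpq hu.aemeasurable
        (g := fun _ => 1) aemeasurable_const
      simp only [Pi.mul_apply, mul_one, ENNReal.one_rpow, setLIntegral_one] at h
      refine h.trans ?_
      have e1 : 1 / (P / t) = t / P := by field_simp
      have e2 : 1 / (P / t).conjExponent = 1 - t / P := by
        have := hpq.inv_add_inv_eq_one
        rw [inv_div] at this
        rw [one_div]; linarith
      rw [e1, e2]
      gcongr
      exact setLIntegral_le_lintegral _ _
    have h2 : μ B ^ (t / P) * Y ≤ N ^ (t / P) := by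
      calc μ B ^ (t / P) * Y ≤ μ B ^ (t / P) * ((μ B)⁻¹ * (N ^ (t / P) * μ B ^ (1 - t / P))) := by
            rw [hY]; gcongr
        _ = (μ B ^ (t / P) * μ B ^ (1 - t / P)) * (μ B)⁻¹ * N ^ (t / P) := by ring
        _ = N ^ (t / P) := by
            rw [← ENNReal.rpow_add _ _ h0 hfin, add_sub_cancel, ENNReal.rpow_one,
              ENNReal.mul_inv_cancel h0 hfin, one_mul]
    have h3 := ENNReal.rpow_le_rpow h2 (by positivity : 0 ≤ 1 / t)
    rw [ENNReal.mul_rpow_of_nonneg _ _ (by positivity), ← ENNReal.rpow_mul,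
      ← ENNReal.rpow_mul] at h3
    rwa [show t / P * (1 / t) = 1 / P by field_simp] at h3
  -- These identities write the left side as `(μ B ^ (1/P) * Y ^ (1/t)) ^ (1 - P κ) * Y ^ (P κ /
  -- t)`, so that `hJ` is used only on the first factor.
  have e1 : 1 / P - κ = 1 / P * (1 - P * κ) := by field_simp
  have e2 : 1 / t = 1 / t * (1 - P * κ) + P * κ / t := by field_simp; ring
  calc μ B ^ (1 / P - κ) * Y ^ (1 / t)
      = (μ B ^ (1 / P) * Y ^ (1 / t)) ^ (1 - P * κ) * Y ^ (P * κ / t) := by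
        rw [ENNReal.mul_rpow_of_nonneg (_ ^ _) _ (by linarith : 0 ≤ 1 - P * κ),
          ← ENNReal.rpow_mul, ← ENNReal.rpow_mul,
          ← e1, mul_assoc, ← ENNReal.rpow_add_of_nonneg _ _
            (mul_nonneg (by positivity) (by linarith)) (by positivity), ← e2]
    _ ≤ _ := by
        gcongr

variable {ι : Type*} [Fintype ι]

/-- The fractional multilinear sparse bound. -/
theorem tsum_prod_cubeAvg_le {n : ℕ} {D S : Set (Cube n)} (hD : IsDyadicLattice D) (hSD : S ⊆ D)
    {η : ℝ} (hη : 0 < η) (hS : IsSparse η S)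
    {α κ P t : ι → ℝ} (hα : ∀ i, 0 < α i) (hκ : ∀ i, 0 < κ i) (hκ1 : ∑ i, κ i = 1)
    (hP : ∀ i, 0 < P i) (hκP : ∀ i, κ i ≤ 1 / P i) (ht : ∀ i, 0 < t i)
    (htP : ∀ i, 1 / t i = 1 / P i + α i)
    {v F : ι → (Fin n → ℝ) → ℝ≥0∞} (hv : ∀ i, Measurable (v i)) (hF : ∀ i, Measurable (F i))
    (hv0 : ∀ i x, v i x ≠ 0) (hvt : ∀ i x, v i x ≠ ∞) (hprod : ∀ x, ∏ i, (v i x)⁻¹ = 1)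
    {K : ℝ≥0∞} (hKt : K ≠ ∞)
    (hK : ∀ Q : Cube n, ∏ i, cubeAvg (1 / α i) (fun x => (v i x)⁻¹) Q ≤ K) :
    ∑' Q : S, (∏ i, cubeAvg (t i) (F i) Q) *
        volume (Q : Cube n).toSet ^ (1 + ∑ i, (1 / P i - κ i)) ≤
      multilinearConst α κ (fun i => P i * κ i / t i) (ENNReal.ofReal η) K *
        ∏ i, (∫⁻ x, (F i x * v i x) ^ P i) ^ (1 / P i) := by
  classical
  set w : ι → (Fin n → ℝ) → ℝ≥0∞ := fun i x => (v i x)⁻¹ ^ (1 / α i) with hwdef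
  have hw : ∀ i, Measurable (w i) := fun i => (hv i).inv.pow_const _
  have hw0 : ∀ i x, w i x ≠ 0 := fun i x =>
    (ENNReal.rpow_pos (pos_iff_ne_zero.2 (ENNReal.inv_ne_zero.2 (hvt i x)))
      (ENNReal.inv_ne_top.2 (hv0 i x))).ne'
  have hwt : ∀ i x, w i x ≠ ∞ := fun i x =>
    ENNReal.rpow_ne_top_of_nonneg (one_div_pos.2 (hα i)).le (ENNReal.inv_ne_top.2 (hv0 i x))
  have hwprod : ∀ x, ∏ i, w i x ^ α i = 1 := fun x => by
    rw [← hprod x]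
    refine Finset.prod_congr rfl fun i _ => ?_
    rw [hwdef, ← ENNReal.rpow_mul, one_div_mul_cancel (hα i).ne', ENNReal.rpow_one]
  have havg : ∀ i (Q : Cube n), cubeAvg (1 / α i) (fun x => (v i x)⁻¹) Q =
      ((volume Q.toSet)⁻¹ * volume.withDensity (w i) Q.toSet) ^ α i := fun i Q => by
    rw [cubeAvg, one_div_one_div, withDensity_apply _ Q.measurableSet_toSet]
  have hM0 : ∀ i (Q : Cube n), volume.withDensity (w i) Q.toSet ≠ 0 := fun i Q h => by
    rw [withDensity_apply_eq_zero (hw i)] at h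
    rw [show {x | w i x ≠ 0} = univ from eq_univ_of_forall (hw0 i), univ_inter] at h
    exact Q.volume_ne_zero h
  simp only [havg] at hK
  -- Local integrability of the `w i` comes from the characteristic: the other factors do not
  -- vanish, so an infinite one would make the product infinite.
  have hMt : ∀ i (Q : Cube n), volume.withDensity (w i) Q.toSet ≠ ∞ := fun i Q h => by
    have hne : ∏ j ∈ Finset.univ.erase i,
        ((volume Q.toSet)⁻¹ * volume.withDensity (w j) Q.toSet) ^ α j ≠ 0 := by
      refine Finset.prod_ne_zero_iff.2 fun j _ => ?_
      rw [Ne, ENNReal.rpow_eq_zero_iff_of_pos (hα j)]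
      exact mul_ne_zero (ENNReal.inv_ne_zero.2 Q.volume_ne_top) (hM0 j Q)
    have hQ := hK Q
    rw [← Finset.mul_prod_erase _ _ (Finset.mem_univ i), h,
      ENNReal.mul_top (ENNReal.inv_ne_zero.2 Q.volume_ne_top), ENNReal.top_rpow_of_pos (hα i),
      ENNReal.top_mul hne] at hQ
    exact hKt (top_le_iff.1 hQ)
  set u : ι → (Fin n → ℝ) → ℝ≥0∞ := fun i x => F i x ^ t i * (w i x)⁻¹ with hudef
  have hu : ∀ i, Measurable (u i) := fun i => ((hF i).pow_const _).mul (hw i).inv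
  have htP' : ∀ i, t i < P i := fun i => by
    have := htP i
    rw [← one_div_lt_one_div (hP i) (ht i)]
    linarith [hα i]
  have hPt : ∀ i, P i / t i = 1 + P i * α i := fun i => by
    rw [div_eq_mul_one_div, htP i, mul_add, mul_one_div_cancel (hP i).ne']
  -- As `P/t = 1 + P α`, the integrand is `F ^ P * w ^ (-P α) = F ^ P * v ^ P`.
  have hnorm : ∀ i, ∫⁻ x, u i x ^ (P i / t i) ∂volume.withDensity (w i) =
      ∫⁻ x, (F i x * v i x) ^ P i := fun i => by
    rw [lintegral_withDensity_eq_lintegral_mul _ (hw i) ((hu i).pow_const _)]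
    refine lintegral_congr fun x => ?_
    have hw' : w i x = v i x ^ (-(1 / α i)) := by
      rw [ENNReal.rpow_neg, ← ENNReal.inv_rpow]
    have hpos : 0 ≤ P i / t i := (div_pos (hP i) (ht i)).le
    rw [Pi.mul_apply, hudef]
    simp only
    rw [ENNReal.mul_rpow_of_nonneg _ _ hpos, ENNReal.mul_rpow_of_nonneg _ _ (hP i).le,
      ← ENNReal.rpow_mul, mul_div_cancel₀ _ (ht i).ne', hw', ← ENNReal.rpow_neg, neg_neg,
      ← ENNReal.rpow_mul, mul_left_comm, ← ENNReal.rpow_add _ _ (hv0 i x) (hvt i x), hPt]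
    congr 2
    have := (hα i).ne'
    field_simp
    ring
  set N : ι → ℝ≥0∞ := fun i => (∫⁻ x, (F i x * v i x) ^ P i) ^ (1 / P i) with hNdef
  have term : ∀ Q : S, (∏ i, cubeAvg (t i) (F i) Q) *
        volume (Q : Cube n).toSet ^ (1 + ∑ i, (1 / P i - κ i)) ≤
      (∏ i, N i ^ (1 - P i * κ i)) * (volume (Q : Cube n).toSet * ∏ i,
      (((volume (Q : Cube n).toSet)⁻¹ * volume.withDensity (w i) (Q : Cube n).toSet) ^ (α i + κ i) *
      ((volume.withDensity (w i) (Q : Cube n).toSet)⁻¹ *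
        ∫⁻ x in (Q : Cube n).toSet, u i x ∂volume.withDensity (w i)) ^ (P i * κ i / t i))) := by
    rintro ⟨Q, -⟩
    simp only
    have hδ : ∀ i, 0 ≤ 1 / P i - κ i := fun i => sub_nonneg.2 (hκP i)
    rw [ENNReal.rpow_add_of_nonneg _ _ zero_le_one (Finset.sum_nonneg fun i _ => hδ i),
      ENNReal.rpow_one, rpow_finsetSum_of_nonneg _ fun i _ => hδ i, mul_left_comm,
      mul_left_comm _ (volume Q.toSet), ← Finset.prod_mul_distrib, ← Finset.prod_mul_distrib]
    gcongr volume Q.toSet * ?_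
    refine Finset.prod_le_prod' fun i _ => ?_
    have hJ := measure_rpow_mul_average_rpow_le (μ := volume.withDensity (w i)) (B := Q.toSet)
      (hu i) (ht i) (htP' i) (hκ i) (hκP i) (hM0 i Q) (hMt i Q)
    rw [hnorm i] at hJ
    rw [cubeAvg_eq_mul_average (hw i) (hF i) (hw0 i) (hwt i) (ht i) Q (hM0 i Q) (hMt i Q)]
    calc ((volume Q.toSet)⁻¹ * volume.withDensity (w i) Q.toSet) ^ (1 / t i) *
          ((volume.withDensity (w i) Q.toSet)⁻¹ *
            ∫⁻ x in Q.toSet, u i x ∂volume.withDensity (w i)) ^ (1 / t i) *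
          volume Q.toSet ^ (1 / P i - κ i)
        = ((volume Q.toSet)⁻¹ * volume.withDensity (w i) Q.toSet) ^ (α i + κ i) *
          (((volume Q.toSet * (volume Q.toSet)⁻¹) * volume.withDensity (w i) Q.toSet) ^
              (1 / P i - κ i) * ((volume.withDensity (w i) Q.toSet)⁻¹ *
            ∫⁻ x in Q.toSet, u i x ∂volume.withDensity (w i)) ^ (1 / t i)) := by
          have e : 1 / t i = (α i + κ i) + (1 / P i - κ i) := by rw [htP i]; ring
          conv_lhs => rw [e, ENNReal.rpow_add_of_nonneg _ _ (add_pos (hα i) (hκ i)).le (hδ i), ← e]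
          rw [mul_assoc (volume Q.toSet), ENNReal.mul_rpow_of_nonneg (volume Q.toSet) _ (hδ i)]
          ring
      _ ≤ ((volume Q.toSet)⁻¹ * volume.withDensity (w i) Q.toSet) ^ (α i + κ i) *
          (N i ^ (1 - P i * κ i) * ((volume.withDensity (w i) Q.toSet)⁻¹ *
            ∫⁻ x in Q.toSet, u i x ∂volume.withDensity (w i)) ^ (P i * κ i / t i)) := by
          rw [ENNReal.mul_inv_cancel Q.volume_ne_zero Q.volume_ne_top, one_mul]
          exact mul_le_mul' le_rfl hJ
      _ = _ := by rw [mul_left_comm]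
  refine (ENNReal.tsum_le_tsum term).trans ?_
  rw [ENNReal.tsum_mul_left]
  have hmain := tsum_prod_average_le hD hSD hη hS hα hκ hκ1
    (ρ := fun i => P i * κ i / t i) (fun i => ?_) hw hu hwprod hK
  · refine (mul_le_mul' le_rfl hmain).trans (le_of_eq ?_)
    rw [mul_left_comm, ← Finset.prod_mul_distrib]
    congr 1
    refine Finset.prod_congr rfl fun i _ => ?_
    have e : P i * κ i / t i / κ i = P i / t i := by
      have := (hκ i).ne'
      field_simp
    have hPκ : P i * κ i ≤ 1 := by
      have := hκP i
      rwa [le_div_iff₀ (hP i), mul_comm] at this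
    rw [e, hnorm, hNdef]
    simp only
    rw [← ENNReal.rpow_mul, ← ENNReal.rpow_add_of_nonneg]
    · congr 1
      have := (hP i).ne'
      field_simp
      ring
    · exact mul_nonneg (one_div_pos.2 (hP i)).le (by linarith)
    · exact (hκ i).le
  · rw [mul_div_right_comm]
    exact lt_mul_of_one_lt_left (hκ i) ((one_lt_div (ht i)).2 (htP' i))

/-! ### Measurable representatives and the exponents of the characteristic -/

theorem IsWeight.exists_measurable_pos {n : ℕ} {w : (Fin n → ℝ) → ℝ} (hw : IsWeight w) :
    ∃ w' : (Fin n → ℝ) → ℝ, Measurable w' ∧ (∀ x, 0 < w' x) ∧ w =ᵐ[volume] w' := by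
  classical
  have hm := hw.aemeasurable.measurable_mk
  refine ⟨fun x => if 0 < hw.aemeasurable.mk w x then hw.aemeasurable.mk w x else 1,
    Measurable.ite (measurableSet_lt measurable_const hm) hm measurable_const, fun x => ?_, ?_⟩
  · dsimp only
    split_ifs with h
    · exact h
    · exact one_pos
  · filter_upwards [hw.aemeasurable.ae_eq_mk, hw.ae_pos] with x hx hpos
    rw [← hx, if_pos hpos]

theorem cubeAvg_congr_ae {n : ℕ} {f g : (Fin n → ℝ) → ℝ≥0∞} (h : f =ᵐ[volume] g) (r : ℝ)
    (Q : Cube n) : cubeAvg r f Q = cubeAvg r g Q := by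
  unfold cubeAvg
  congr 2
  refine lintegral_congr_ae (ae_restrict_of_ae ?_)
  filter_upwards [h] with x hx
  rw [hx]

/-- The density is positive almost everywhere. This carries measurability of functions in weighted
spaces over to Lebesgue measure. -/
theorem IsWeight.absolutelyContinuous {n : ℕ} {w : (Fin n → ℝ) → ℝ} (hw : IsWeight w) (a : ℝ) :
    volume ≪ weightMeasure w a := by
  refine withDensity_absolutelyContinuous' (hw.aemeasurable.pow_const a).ennreal_ofReal ?_
  filter_upwards [hw.ae_pos] with x hx
  simpa using Real.rpow_pos_of_pos hx a

theorem IsWeight.exists_measurable_enorm {n : ℕ} {w : (Fin n → ℝ) → ℝ} (hw : IsWeight w)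
    {f : (Fin n → ℝ) → ℂ} {p : ℝ≥0∞} {a : ℝ} (hf : MemLp f p (weightMeasure w a)) :
    ∃ F : (Fin n → ℝ) → ℝ≥0∞, Measurable F ∧ (fun x => ‖f x‖ₑ) =ᵐ[volume] F :=
  (hf.1.mono_ac (hw.absolutelyContinuous a)).enorm

theorem IsWeight.mul {n : ℕ} {w₁ w₂ : (Fin n → ℝ) → ℝ} (h₁ : IsWeight w₁) (h₂ : IsWeight w₂) :
    IsWeight fun x => w₁ x * w₂ x where
  aemeasurable := h₁.aemeasurable.mul h₂.aemeasurable
  ae_pos := by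
    filter_upwards [h₁.ae_pos, h₂.ae_pos] with x hx hy using mul_pos hx hy

/-- The exponent of the dual factor as a reciprocal. -/
theorem dualFactor_eq {n : ℕ} {r p : ℝ} (hr : 0 < r) (hrp : r < p) (w : (Fin n → ℝ) → ℝ)
    (Q : Cube n) : dualFactor r p w Q =
      cubeAvg (1 / (1 / r - 1 / p)) (fun x => (ENNReal.ofReal (w x))⁻¹) Q := by
  have hp : 0 < p := hr.trans hrp
  have h : r * p / (p - r) = 1 / (1 / r - 1 / p) := by
    rw [div_sub_div _ _ hr.ne' hp.ne', one_div_div]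
    ring
  rw [dualFactor, if_neg hrp.ne', h]

/-- The exponent of the product factor as a reciprocal. -/
theorem productFactor_eq {n : ℕ} {r p : ℝ} (hr : 1 ≤ r) (hp : 1 < p) (hrp : r < p.conjExponent)
    (w : (Fin n → ℝ) → ℝ) (Q : Cube n) : productFactor r p w Q =
      cubeAvg (1 / (1 / r - 1 / p.conjExponent)) (fun x => ENNReal.ofReal (w x)) Q := by
  have hp0 : 0 < p - 1 := by linarith
  rw [productFactor]
  -- For `r = 1` the value `Real.conjExponent 1 = 0` is meaningless, but `1 / r - 1 / p'` is `1 /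
  -- p`, so the reciprocal form covers both cases.
  split_ifs with h
  · have e : 1 / (1 / r - 1 / p.conjExponent) = p := by
      rw [h, Real.conjExponent]
      field_simp
      simp
    rw [e]
  · have hr0 : 0 < r - 1 := by
      have := lt_of_le_of_ne hr (Ne.symm h)
      linarith
    have hlt : 0 < p - r * (p - 1) := by
      rw [Real.conjExponent, lt_div_iff₀ hp0] at hrp
      linarith
    have e : r.conjExponent * p / (r.conjExponent - p) = 1 / (1 / r - 1 / p.conjExponent) := by
      have h1 : r / (r - 1) - p = (p - r * (p - 1)) / (r - 1) := by
        field_simp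
        ring
      have h2 : 1 / r - 1 / (p / (p - 1)) = (p - r * (p - 1)) / (r * p) := by
        field_simp
      rw [Real.conjExponent, Real.conjExponent, h1, h2]
      field_simp
    rw [e]

end SparseForm

/-! ### Conjugate exponents, and the bilinear form as a three-function case -/

namespace SparseForm

/-- Arguing with reciprocals in `ℝ≥0∞` includes `s = ∞`. Both conjugate pairs of reciprocals sum to
one, so a smaller `s⁻¹` forces a larger reciprocal of `s'`. -/
theorem one_le_and_lt_conjExponent {q s' : ℝ} {s : ℝ≥0∞} (hq : 1 < q) (hqs : ENNReal.ofReal q < s)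
    (hs' : ENNReal.HolderConjugate s (ENNReal.ofReal s')) : 1 ≤ s' ∧ s' < q.conjExponent := by
  have h1 : s⁻¹ + (ENNReal.ofReal s')⁻¹ = 1 := by
    simpa using hs'.inv_add_inv_eq_inv
  have hqq := Real.HolderConjugate.conjExponent hq
  have h2 : (ENNReal.ofReal q)⁻¹ + (ENNReal.ofReal q.conjExponent)⁻¹ = 1 := by
    simpa using hqq.ennrealOfReal.inv_add_inv_eq_inv
  have hle : 1 ≤ s' := by
    rw [← ENNReal.one_le_ofReal, ← ENNReal.inv_le_one, ← h1]
    exact le_add_self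
  refine ⟨hle, ?_⟩
  have hs1 : s⁻¹ < (ENNReal.ofReal q)⁻¹ := ENNReal.inv_lt_inv.2 hqs
  rw [← ENNReal.ofReal_lt_ofReal_iff hqq.symm.pos, ← ENNReal.inv_lt_inv]
  by_contra! hcon
  have hne : (ENNReal.ofReal q.conjExponent)⁻¹ ≠ ∞ := by
    simpa using hqq.symm.pos
  have hlt := ENNReal.add_lt_add_of_lt_of_le (ne_top_of_le_ne_top hne hcon) hs1 hcon
  rw [h1, h2] at hlt
  exact lt_irrefl _ hlt

theorem enorm_complex_ofReal {r : ℝ} (hr : 0 ≤ r) : ‖(r : ℂ)‖ₑ = ENNReal.ofReal r := by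
  rw [← ofReal_norm, Complex.norm_of_nonneg hr]

theorem eLpNorm_eq_of_enorm_ae_eq {X : Type*} [MeasurableSpace X] {μ : Measure X} {f : X → ℂ}
    {g : X → ℝ≥0∞} (h : (fun x => ‖f x‖ₑ) =ᵐ[μ] g) {p : ℝ} (hp : 0 < p) :
    eLpNorm f (ENNReal.ofReal p) μ = (∫⁻ x, g x ^ p ∂μ) ^ (1 / p) := by
  rw [eLpNorm_eq_lintegral_rpow_enorm_toReal (by simpa using hp) ENNReal.ofReal_ne_top,
    ENNReal.toReal_ofReal hp.le]
  congr 1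
  refine lintegral_congr_ae ?_
  filter_upwards [h] with x hx
  rw [hx]

end SparseForm

theorem theorem4p1 (n : ℕ) (hn : 1 ≤ n) (r₁ r₂ p₁ p₂ q₁ p q s' β₁ η : ℝ) (s : ℝ≥0∞)
    (hr₁ : 1 ≤ r₁) (hrp₁ : r₁ < p₁) (hpq₁ : p₁ ≤ q₁)
    (hr₂ : 1 ≤ r₂) (hrp₂ : r₂ < p₂)
    (hp : 1 < p) (hpq : p ≤ q) (hqs : ENNReal.ofReal q < s)
    (hpeq : 1 / p = 1 / p₁ + 1 / p₂) (hqeq : 1 / q = 1 / q₁ + 1 / p₂)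
    (hs' : ENNReal.HolderConjugate s (ENNReal.ofReal s'))
    (hβ₁ : β₁ = r₁ * (1 / p₁ - 1 / q₁))
    (hη₀ : 0 < η) (hη₁ : η < 1) (K : ℝ≥0) :
    ∃ C : ℝ≥0, ∀ lam₁ ω₂ : (Fin n → ℝ) → ℝ,
      SparseForm.IsWeight lam₁ → SparseForm.IsWeight ω₂ →
      SparseForm.weightConst q₁ p₂ r₁ r₂ s' lam₁ ω₂ ≤ K →
      ∀ D S : Set (SparseForm.Cube n),
        SparseForm.IsDyadicLattice D → S ⊆ D → SparseForm.IsSparse η S →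
      ∀ f₁ f₂ g : (Fin n → ℝ) → ℂ,
        MemLp f₁ (ENNReal.ofReal p₁) (SparseForm.weightMeasure lam₁ p₁) →
        MemLp f₂ (ENNReal.ofReal p₂) (SparseForm.weightMeasure ω₂ p₂) →
        MemLp g (ENNReal.ofReal q.conjExponent)
          (SparseForm.weightMeasure (fun x => lam₁ x * ω₂ x) (-q.conjExponent)) →
        SparseForm.sparseForm S (r₁ / (1 + β₁)) r₂ s' (1 + β₁ / r₁) f₁ f₂ g ≤
          C * eLpNorm (fun x => f₁ x * (lam₁ x : ℂ)) (ENNReal.ofReal p₁) volume *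
            eLpNorm (fun x => f₂ x * (ω₂ x : ℂ)) (ENNReal.ofReal p₂) volume *
            eLpNorm (fun x => g x * ((lam₁ x * ω₂ x : ℝ) : ℂ)⁻¹)
              (ENNReal.ofReal q.conjExponent) volume := by
  have hp₁0 : 0 < p₁ := by linarith
  have hp₂0 : 0 < p₂ := by linarith
  have hq₁0 : 0 < q₁ := by linarith
  have hq1 : 1 < q := by linarith
  have hqq := Real.HolderConjugate.conjExponent hq1
  have hq'0 := hqq.symm.pos
  have hq' : 1 / q + 1 / q.conjExponent = 1 := by simpa using hqq.inv_add_inv_eq_one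
  obtain ⟨hs'1, hs'q⟩ := SparseForm.one_le_and_lt_conjExponent hq1 hqs hs'
  have hpq₁' : 1 / q₁ ≤ 1 / p₁ := one_div_le_one_div_of_le hp₁0 hpq₁
  have hr₁0 : 0 < r₁ := by linarith
  have hβ : 0 < 1 + β₁ := by
    have : 0 ≤ β₁ := by rw [hβ₁]; exact mul_nonneg hr₁0.le (by linarith)
    linarith
  have hβr : β₁ / r₁ = 1 / p₁ - 1 / q₁ := by rw [hβ₁, mul_div_cancel_left₀ _ hr₁0.ne']
  have ht₁ : 1 / (r₁ / (1 + β₁)) = 1 / p₁ + (1 / r₁ - 1 / q₁) := by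
    rw [one_div_div, add_div, hβr]; ring
  set α : Fin 3 → ℝ := ![1 / r₁ - 1 / q₁, 1 / r₂ - 1 / p₂, 1 / s' - 1 / q.conjExponent] with hα
  -- Taking `1 / q₁` instead of `1 / p₁` makes the sum one; the deficit `1 / p₁ - 1 / q₁ = β₁ / r₁`
  -- is the extra power of `|Q|`.
  set κ : Fin 3 → ℝ := ![1 / q₁, 1 / p₂, 1 / q.conjExponent] with hκ
  set P : Fin 3 → ℝ := ![p₁, p₂, q.conjExponent] with hP
  set t : Fin 3 → ℝ := ![r₁ / (1 + β₁), r₂, s'] with ht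
  have hα0 : ∀ i, 0 < α i := by
    rw [Fin.forall_fin_succ, Fin.forall_fin_two]
    exact ⟨sub_pos.2 (one_div_lt_one_div_of_lt hr₁0 (hrp₁.trans_le hpq₁)),
      sub_pos.2 (one_div_lt_one_div_of_lt (by linarith) hrp₂),
      sub_pos.2 (one_div_lt_one_div_of_lt (by linarith) hs'q)⟩
  have hκ0 : ∀ i, 0 < κ i := by
    rw [Fin.forall_fin_succ, Fin.forall_fin_two]
    exact ⟨one_div_pos.2 hq₁0, one_div_pos.2 hp₂0, one_div_pos.2 hq'0⟩
  have hP0 : ∀ i, 0 < P i := by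
    rw [Fin.forall_fin_succ, Fin.forall_fin_two]
    exact ⟨hp₁0, hp₂0, hq'0⟩
  have ht0 : ∀ i, 0 < t i := by
    rw [Fin.forall_fin_succ, Fin.forall_fin_two]
    exact ⟨div_pos hr₁0 hβ, one_pos.trans_le hr₂, one_pos.trans_le hs'1⟩
  have hκP : ∀ i, κ i ≤ 1 / P i := by
    rw [Fin.forall_fin_succ, Fin.forall_fin_two]
    exact ⟨hpq₁', le_rfl, le_rfl⟩
  have htP : ∀ i, 1 / t i = 1 / P i + α i := by
    rw [Fin.forall_fin_succ, Fin.forall_fin_two]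
    exact ⟨ht₁, (add_sub_cancel _ _).symm, (add_sub_cancel _ _).symm⟩
  have hκ1 : ∑ i, κ i = 1 := by
    rw [Fin.sum_univ_three]
    change 1 / q₁ + 1 / p₂ + 1 / q.conjExponent = 1
    rw [← hqeq, hq']
  have hρ : ∀ i, κ i < P i * κ i / t i := fun i => by
    rw [mul_div_right_comm]
    refine lt_mul_of_one_lt_left (hκ0 i) ((one_lt_div (ht0 i)).2 ?_)
    rw [← one_div_lt_one_div (hP0 i) (ht0 i), htP i]
    linarith [hα0 i]
  have hC := SparseForm.multilinearConst_ne_top hα0 hκ0 hρ (c := ENNReal.ofReal η)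
    (by simpa using hη₀) ENNReal.ofReal_ne_top (ENNReal.coe_ne_top (r := K))
  refine ⟨(SparseForm.multilinearConst α κ (fun i => P i * κ i / t i) (ENNReal.ofReal η) K).toNNReal,
    fun lam₁ ω₂ hlam hω hK D S hD hSD hS f₁ f₂ g hf₁ hf₂ hg => ?_⟩
  rw [ENNReal.coe_toNNReal hC]
  obtain ⟨l, hlm, hl0, hl⟩ := hlam.exists_measurable_pos
  obtain ⟨o, hom, ho0, ho⟩ := hω.exists_measurable_pos
  obtain ⟨F₁, hF₁m, hF₁⟩ := hlam.exists_measurable_enorm hf₁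
  obtain ⟨F₂, hF₂m, hF₂⟩ := hω.exists_measurable_enorm hf₂
  obtain ⟨G, hGm, hG⟩ := (hlam.mul hω).exists_measurable_enorm hg
  -- Everywhere positive representatives make the product of the three weights equal to one at every
  -- point.
  set v : Fin 3 → (Fin n → ℝ) → ℝ≥0∞ := ![fun x => ENNReal.ofReal (l x),
    fun x => ENNReal.ofReal (o x), fun x => (ENNReal.ofReal (l x * o x))⁻¹] with hv
  set F : Fin 3 → (Fin n → ℝ) → ℝ≥0∞ := ![F₁, F₂, G] with hF
  have hlo : ∀ x, ENNReal.ofReal (l x * o x) ≠ 0 := fun x => by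
    simpa using mul_pos (hl0 x) (ho0 x)
  have hvm : ∀ i, Measurable (v i) := by
    rw [Fin.forall_fin_succ, Fin.forall_fin_two]
    exact ⟨hlm.ennreal_ofReal, hom.ennreal_ofReal, (hlm.mul hom).ennreal_ofReal.inv⟩
  have hFm : ∀ i, Measurable (F i) := by
    rw [Fin.forall_fin_succ, Fin.forall_fin_two]
    exact ⟨hF₁m, hF₂m, hGm⟩
  have hv0 : ∀ i x, v i x ≠ 0 := by
    rw [Fin.forall_fin_succ, Fin.forall_fin_two]
    exact ⟨fun x => (ENNReal.ofReal_pos.2 (hl0 x)).ne', fun x => (ENNReal.ofReal_pos.2 (ho0 x)).ne',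
      fun x => ENNReal.inv_ne_zero.2 ENNReal.ofReal_ne_top⟩
  have hvt : ∀ i x, v i x ≠ ∞ := by
    rw [Fin.forall_fin_succ, Fin.forall_fin_two]
    exact ⟨fun x => ENNReal.ofReal_ne_top, fun x => ENNReal.ofReal_ne_top,
      fun x => ENNReal.inv_ne_top.2 (hlo x)⟩
  have hprod : ∀ x, ∏ i, (v i x)⁻¹ = 1 := fun x => by
    rw [Fin.prod_univ_three]
    change (ENNReal.ofReal (l x))⁻¹ * (ENNReal.ofReal (o x))⁻¹ *
      ((ENNReal.ofReal (l x * o x))⁻¹)⁻¹ = 1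
    rw [inv_inv, ← ENNReal.mul_inv (Or.inr ENNReal.ofReal_ne_top) (Or.inl ENNReal.ofReal_ne_top),
      ← ENNReal.ofReal_mul (hl0 x).le, ENNReal.inv_mul_cancel (hlo x) ENNReal.ofReal_ne_top]
  have hKQ : ∀ Q : SparseForm.Cube n,
      ∏ i, SparseForm.cubeAvg (1 / α i) (fun x => (v i x)⁻¹) Q ≤ K := fun Q => by
    have hQ := (le_iSup (fun Q => SparseForm.productFactor s' (1 / q₁ + 1 / p₂)⁻¹
      (fun x => lam₁ x * ω₂ x) Q * SparseForm.dualFactor r₁ q₁ lam₁ Q *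
        SparseForm.dualFactor r₂ p₂ ω₂ Q) Q).trans hK
    rw [← hqeq, one_div, inv_inv, SparseForm.productFactor_eq hs'1 hq1 hs'q,
      SparseForm.dualFactor_eq hr₁0 (hrp₁.trans_le hpq₁),
      SparseForm.dualFactor_eq (by linarith) hrp₂] at hQ
    have e₀ : SparseForm.cubeAvg (1 / (1 / r₁ - 1 / q₁)) (fun x => (ENNReal.ofReal (lam₁ x))⁻¹) Q =
        SparseForm.cubeAvg (1 / α 0) (fun x => (v 0 x)⁻¹) Q :=
      SparseForm.cubeAvg_congr_ae (hl.fun_comp fun y => (ENNReal.ofReal y)⁻¹) _ Q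
    have e₁ : SparseForm.cubeAvg (1 / (1 / r₂ - 1 / p₂)) (fun x => (ENNReal.ofReal (ω₂ x))⁻¹) Q =
        SparseForm.cubeAvg (1 / α 1) (fun x => (v 1 x)⁻¹) Q :=
      SparseForm.cubeAvg_congr_ae (ho.fun_comp fun y => (ENNReal.ofReal y)⁻¹) _ Q
    have e₂ : SparseForm.cubeAvg (1 / (1 / s' - 1 / q.conjExponent))
        (fun x => ENNReal.ofReal (lam₁ x * ω₂ x)) Q =
        SparseForm.cubeAvg (1 / α 2) (fun x => (v 2 x)⁻¹) Q := by
      refine SparseForm.cubeAvg_congr_ae ?_ _ Q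
      filter_upwards [hl, ho] with x hx hy
      change _ = ((ENNReal.ofReal (l x * o x))⁻¹)⁻¹
      rw [inv_inv, hx, hy]
    rw [e₀, e₁, e₂] at hQ
    rw [Fin.prod_univ_three, mul_comm, ← mul_assoc]
    exact hQ
  have hmain := SparseForm.tsum_prod_cubeAvg_le hD hSD hη₀ hS hα0 hκ0 hκ1 hP0 hκP ht0 htP hvm hFm
    hv0 hvt hprod ENNReal.coe_ne_top hKQ
  have hsum : 1 + ∑ i, (1 / P i - κ i) = 1 + β₁ / r₁ := by
    rw [Fin.sum_univ_three]
    change 1 + ((1 / p₁ - 1 / q₁) + (1 / p₂ - 1 / p₂) + (1 / q.conjExponent - 1 / q.conjExponent)) = _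
    rw [hβr]; ring
  rw [hsum] at hmain
  simp only [Fin.prod_univ_three] at hmain
  have n₁ : eLpNorm (fun x => f₁ x * (lam₁ x : ℂ)) (ENNReal.ofReal p₁) volume =
      (∫⁻ x, (F 0 x * v 0 x) ^ P 0) ^ (1 / P 0) := by
    refine SparseForm.eLpNorm_eq_of_enorm_ae_eq ?_ hp₁0
    filter_upwards [hF₁, hl] with x hx hy
    change _ = F₁ x * ENNReal.ofReal (l x)
    rw [enorm_mul, hx, hy, SparseForm.enorm_complex_ofReal (hl0 x).le]
  have n₂ : eLpNorm (fun x => f₂ x * (ω₂ x : ℂ)) (ENNReal.ofReal p₂) volume =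
      (∫⁻ x, (F 1 x * v 1 x) ^ P 1) ^ (1 / P 1) := by
    refine SparseForm.eLpNorm_eq_of_enorm_ae_eq ?_ hp₂0
    filter_upwards [hF₂, ho] with x hx hy
    change _ = F₂ x * ENNReal.ofReal (o x)
    rw [enorm_mul, hx, hy, SparseForm.enorm_complex_ofReal (ho0 x).le]
  have n₃ : eLpNorm (fun x => g x * ((lam₁ x * ω₂ x : ℝ) : ℂ)⁻¹)
      (ENNReal.ofReal q.conjExponent) volume =
      (∫⁻ x, (F 2 x * v 2 x) ^ P 2) ^ (1 / P 2) := by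
    refine SparseForm.eLpNorm_eq_of_enorm_ae_eq ?_ hq'0
    filter_upwards [hG, hl, ho] with x hx hy hz
    change _ = G x * (ENNReal.ofReal (l x * o x))⁻¹
    have hpos := mul_pos (hl0 x) (ho0 x)
    rw [enorm_mul, hx, hy, hz, enorm_inv (by exact_mod_cast hpos.ne'),
      SparseForm.enorm_complex_ofReal hpos.le]
  rw [n₁, n₂, n₃, mul_assoc, mul_assoc, ← mul_assoc (_ ^ _)]
  refine le_of_eq_of_le ?_ hmain
  refine tsum_congr fun Q => ?_
  rw [SparseForm.cubeAvg_congr_ae hF₁, SparseForm.cubeAvg_congr_ae hF₂,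
    SparseForm.cubeAvg_congr_ae hG]
  rfl
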